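/- Let $r>0$, $\sigma\in\mathbb{R}^d$, and let $X=(X_t)_{t\ge 0}$ be the logarithmic price process of the $d$-dimensional Black--Scholes model with discount rate $r$ and volatility vector $\sigma$, i.e. $(X_t)_i=(X_0)_i+\sigma_iB^{(i)}_t+\left(r-\frac{\sigma_i^2}{2}\right)t$ for all $t\ge 0$ and $i\in\{1,\dots,d\}$ with independent standard Brownian motions $B^{(1)},\dots,B^{(d)}$; let $(\mathbb{P}^x)_{x\in\mathbb{R}^d}$ be the corresponding family of risk-neutral measures, so that $X_0=x$ holds $\mathbb{P}^x$-almost surely, and write $\mathbb{E}^x$ for the expectation with respect to $\mathbb{P}^x$. Let $\alpha,\gamma\in\mathbb{R}^d$, let $G=\gamma+\{x\in\mathbb{R}^d : {}^t\alpha x<0\}$, put $\delta:=\sqrt{\sum_{i=1}^d|\alpha_i\sigma_i|^2}$ and $\mu:=\left(r-\frac{\sigma_1^2}{2},\dots,r-\frac{\sigma_d^2}{2}\right)$, and assume $\delta>0$. For $s>0$ let $\tau_G^{s\mathbb{N}}:=\min\{t\in\{s,2s,3s,\dots\} : X_t\in G\}$ (with value $+\infty$ if there is no such $t$, and $e^{-r\cdot\infty}:=0$).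 Then for every $s>0$ the limit $$\rho(s)(\gamma):=\lim_{t\downarrow 0}\mathbb{E}^\gamma\left[e^{-r\tau_G^{t\mathbb{N}}}-e^{-r\tau_G^{s\mathbb{N}}}\right]$$ exists, and the following holds. (i) If ${}^t\alpha\mu\ge 0$, then there exist constants $c_0,C_0>0$ such that for all sufficiently small $s>0$ $$c_0\,s^{\frac12}\le\rho(s)(\gamma)\le C_0\,s^{\frac{1}{2\sqrt2}}.$$ (ii) If ${}^t\alpha\mu\le 0$ and $r>\frac{|{}^t\alpha\mu|^2}{2\delta^2}$, then there exist constants $c_1,C_1>0$ such that for all sufficiently small $s>0$ $$c_1\,s^{\frac{1}{\sqrt2}}\le\rho(s)(\gamma)\le C_1\,s^{\frac12}.$$ -/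

import Mathlib

open MeasureTheory ProbabilityTheory Filter Topology
open scoped NNReal ENNReal

noncomputable section

/-- The `d`-dimensional Black–Scholes model (in logarithmic prices) with discount rate `r` and
volatility vector `σ`, together with its family `(Q x)` of risk-neutral measures: `Q x` is the law
for the start log-price `x`. Under every `Q x`, the processes `B i` are independent standard
Brownian motions, `X` starts in `x`, and
`(X_t)_i = (X_0)_i + σ_i B^{(i)}_t + (r - σ_i ^ 2 / 2) t`. -/
structure IsBlackScholesModel {d : ℕ} {Ω : Type*} [MeasurableSpace Ω] (r : ℝ) (σ : Fin d → ℝ)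
    (B : Fin d → ℝ≥0 → Ω → ℝ) (X : ℝ≥0 → Ω → (Fin d → ℝ))
    (Q : (Fin d → ℝ) → Measure Ω) : Prop where
  isProbabilityMeasure : ∀ x, IsProbabilityMeasure (Q x)
  measurable_B : ∀ i t, Measurable (B i t)
  measurable_X : ∀ t, Measurable (X t)
  isBrownian : ∀ x i, IsBrownianReal (B i) (Q x)
  indep : ∀ x, iIndepFun (fun (i : Fin d) (ω : Ω) (t : ℝ≥0) => B i t ω) (Q x)
  start : ∀ x, ∀ᵐ ω ∂(Q x), X 0 ω = x
  dynamics : ∀ x, ∀ᵐ ω ∂(Q x), ∀ (t : ℝ≥0) (i : Fin d),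
    X t ω i = X 0 ω i + σ i * B i t ω + (r - σ i ^ 2 / 2) * (t : ℝ)

/-- The set `s ℕ = {s, 2 s, 3 s, …}` of positive multiples of the mesh size `s`. -/
def positiveMultiples (s : ℝ≥0) : Set ℝ≥0 :=
  {t | ∃ n : ℕ, 1 ≤ n ∧ t = (n : ℝ≥0) * s}

/-- The first entry time in `I` into `G`, with value `∞` if `X` is not in `G` at any time in `I`.
(For `I = s ℕ` with `s > 0` the infimum of a nonempty set of entry times is attained.) -/
def entryTime {Ω E : Type*} (X : ℝ≥0 → Ω → E) (I : Set ℝ≥0) (G : Set E) (ω : Ω) : ℝ≥0∞ :=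
  sInf ((fun t : ℝ≥0 => (t : ℝ≥0∞)) '' {t | t ∈ I ∧ X t ω ∈ G})

open Classical in
/-- The discount factor `e^{-r τ}`, which is `0` for `τ = ∞`. -/
def discountFactor (r : ℝ) (τ : ℝ≥0∞) : ℝ :=
  if τ = ∞ then 0 else Real.exp (-(r * τ.toReal))

/-- The expectation `E^x [e^{-r τ_G^{t ℕ}} - e^{-r τ_G^{s ℕ}}]`. -/
def expectedDiscountDifference {Ω E : Type*} [MeasurableSpace Ω] (r : ℝ) (X : ℝ≥0 → Ω → E)
    (Q : E → Measure Ω) (G : Set E) (s : ℝ≥0) (x : E) (t : ℝ≥0) : ℝ :=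
  ∫ ω, (discountFactor r (entryTime X (positiveMultiples t) G ω)
    - discountFactor r (entryTime X (positiveMultiples s) G ω)) ∂(Q x)

/-- The continuity correction
`ρ(s)(x) = lim_{t ↓ 0} E^x [e^{-r τ_G^{t ℕ}} - e^{-r τ_G^{s ℕ}}]`, provided that the limit
exists. -/
def continuityCorrection {Ω E : Type*} [MeasurableSpace Ω] (r : ℝ) (X : ℝ≥0 → Ω → E)
    (Q : E → Measure Ω) (G : Set E) (s : ℝ≥0) (x : E) : ℝ :=
  limUnder (𝓝[>] (0 : ℝ≥0)) (expectedDiscountDifference r X Q G s x)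

end

/-!
Projecting on `α` reduces the problem to one dimension: under `Q γ`, the process is in `G` at the
time `n s` if and only if `S n < 0`, where `S` is a random walk with independent increments of law
`gaussianReal (m * s) (δ ^ 2 * s)` and `m = α ⬝ᵥ μ`. So `E[e^{-r τ}] = E[q ^ N]` with `q = e^{-r s}`
and `N` the first time `n ≥ 1` at which `S n < 0`.

Let `θ > 0` be the positive root of `δ² θ² / 2 - m θ = r`. Then `q ^ n * exp (-θ * S n)` is a
martingale which is at most `q ^ n` as long as the walk is nonnegative, so optional stopping gives
`E[q ^ N * exp (θ * H)] = 1` with the overshoot `H = -S N > 0` (`tsum_exitMass_eq_one`), that is,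
`1 - E[q ^ N] = E[q ^ N * (exp (θ * H) - 1)]`. This number is of the exact order `√s`, whatever the
sign of `m`.

* Lower bound: already the overshoot of the first step contributes a multiple of `√s`
  (`discountedExit_add_le_one`, `exists_first_overshoot_bound`).
* Upper bound: among the Gaussian steps from some `y ≥ 0` to a negative position, those from `y = 0`
  have the stochastically largest overshoot (`integral_exp_sub_gaussianReal_nonpos`, an association
  inequality between the decreasing exponential and the increasing density ratio), and for these
  `E[exp (θ * H) - 1] ≤ C * √s` by scaling (`exists_overshoot_bound`). Summing over the time of the
  exit gives `1 ≤ (1 + C * √s) * E[q ^ N]` (`one_le_mul_discountedExit`).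

In particular `E^γ[e^{-r τ}] → 1` as the mesh tends to `0`, so that the limit defining the
continuity correction exists and equals `1 - E^γ[e^{-r τ}]` for the mesh `s`. As
`s ≤ 1`, the powers of `s` in the statement compare with `√s` in the required direction.
-/

/-! ### Exit of a random walk from the half-line -/

/-- The position after `n` steps of the random walk with increments `ξ 0, ξ 1, …`. -/
def walk {Ω : Type*} (ξ : ℕ → Ω → ℝ) (n : ℕ) (ω : Ω) : ℝ := ∑ k ∈ Finset.range n, ξ k ω

/-- The event that the walk is nonnegative at the times `1, …, n`. -/
def stayNonneg {Ω : Type*} (ξ : ℕ → Ω → ℝ) (n : ℕ) : Set Ω :=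
  {ω | ∀ k < n, 0 ≤ walk ξ (k + 1) ω}

/-- The event that the first time `≥ 1` at which the walk is negative is `n + 1`. -/
def firstNeg {Ω : Type*} (ξ : ℕ → Ω → ℝ) (n : ℕ) : Set Ω :=
  stayNonneg ξ n ∩ {ω | walk ξ (n + 1) ω < 0}

lemma walk_succ {Ω : Type*} (ξ : ℕ → Ω → ℝ) (n : ℕ) (ω : Ω) :
    walk ξ (n + 1) ω = walk ξ n ω + ξ n ω :=
  Finset.sum_range_succ _ _

lemma stayNonneg_succ {Ω : Type*} (ξ : ℕ → Ω → ℝ) (n : ℕ) :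
    stayNonneg ξ (n + 1) = stayNonneg ξ n \ {ω | walk ξ (n + 1) ω < 0} := by
  ext ω
  simp only [stayNonneg, Set.mem_sdiff, Set.mem_ofPred_eq, not_lt, Nat.lt_succ_iff_lt_or_eq]
  grind

lemma walk_nonneg_of_mem_stayNonneg {Ω : Type*} {ξ : ℕ → Ω → ℝ} {n : ℕ} {ω : Ω}
    (h : ω ∈ stayNonneg ξ n) : 0 ≤ walk ξ n ω := by
  cases n with
  | zero => simp [walk]
  | succ n => exact h n n.lt_succ_self

section Walk

variable {Ω : Type*} [MeasurableSpace Ω] {P : Measure Ω} {ξ : ℕ → Ω → ℝ} {ν : Measure ℝ}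

lemma measurable_walk (hξ : ∀ k, Measurable (ξ k)) (n : ℕ) : Measurable (walk ξ n) :=
  Finset.measurable_fun_sum _ fun k _ => hξ k

lemma measurableSet_walk_neg (hξ : ∀ k, Measurable (ξ k)) (n : ℕ) :
    MeasurableSet {ω | walk ξ n ω < 0} :=
  measurableSet_lt (measurable_walk hξ n) measurable_const

lemma measurableSet_stayNonneg (hξ : ∀ k, Measurable (ξ k)) (n : ℕ) :
    MeasurableSet (stayNonneg ξ n) := by
  induction n with
  | zero => simp [stayNonneg]
  | succ n ih => rw [stayNonneg_succ]; exact ih.diff (measurableSet_walk_neg hξ _)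

lemma measurableSet_firstNeg (hξ : ∀ k, Measurable (ξ k)) (n : ℕ) :
    MeasurableSet (firstNeg ξ n) :=
  (measurableSet_stayNonneg hξ n).inter (measurableSet_walk_neg hξ _)

/-- Markov property of the walk killed when it becomes negative: conditionally on the first `n`
steps, the next step has law `ν`. -/
lemma setLIntegral_stayNonneg_eq [IsProbabilityMeasure P] (hξ : ∀ k, Measurable (ξ k))
    (hind : ∀ n, IndepFun (fun ω (i : Finset.range n) => ξ i ω) (ξ n) P)
    (hlaw : ∀ k, P.map (ξ k) = ν) (n : ℕ) {F : ℝ → ℝ → ℝ≥0∞}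
    (hF : Measurable (Function.uncurry F)) :
    ∫⁻ ω in stayNonneg ξ n, F (walk ξ n ω) (ξ n ω) ∂P
      = ∫⁻ ω in stayNonneg ξ n, ∫⁻ x, F (walk ξ n ω) x ∂ν ∂P := by
  have hν : IsProbabilityMeasure ν := hlaw 0 ▸ Measure.isProbabilityMeasure_map (hξ 0).aemeasurable
  -- the past enters only through the pair `V` of the survival indicator and the position
  let V : Ω → ℝ≥0∞ × ℝ := fun ω => ((stayNonneg ξ n).indicator 1 ω, walk ξ n ω)
  have hV : Measurable V :=
    (measurable_one.indicator (measurableSet_stayNonneg hξ n)).prodMk (measurable_walk hξ n)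
  have hVind : IndepFun V (ξ n) P := by
    let η : ℕ → (Finset.range n → ℝ) → ℝ := fun k u =>
      if hk : k ∈ Finset.range n then u ⟨k, hk⟩ else 0
    have hη : ∀ k, Measurable (η k) := by
      intro k
      by_cases hk : k ∈ Finset.range n
      · simp only [η, hk, dite_true]; exact measurable_pi_apply _
      · simp only [η, hk, dite_false]; exact measurable_const
    have hW : ∀ k ≤ n, ∀ ω, walk η k (fun i : Finset.range n => ξ i ω) = walk ξ k ω := by
      intro k hk ω
      refine Finset.sum_congr rfl fun j hj => ?_
      have : j ∈ Finset.range n := Finset.mem_range.2 ((Finset.mem_range.1 hj).trans_le hk)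
      simp only [η, this, dite_true]
    have hVeq : V = (fun u => ((stayNonneg η n).indicator (fun _ => (1 : ℝ≥0∞)) u, walk η n u)) ∘
        (fun ω (i : Finset.range n) => ξ i ω) := by
      funext ω
      have hmem : (fun i : Finset.range n => ξ i ω) ∈ stayNonneg η n ↔ ω ∈ stayNonneg ξ n := by
        refine forall₂_congr fun k hk => ?_
        rw [hW (k + 1) hk ω]
      by_cases hω : ω ∈ stayNonneg ξ n
      · simp [V, hmem, hω, hW n le_rfl ω]
      · simp [V, hmem, hω, hW n le_rfl ω]
    rw [hVeq]
    exact (hind n).comp ((measurable_const.indicator (measurableSet_stayNonneg hη n)).prodMk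
      (measurable_walk hη n)) measurable_id
  have hprod : P.map (fun ω => (V ω, ξ n ω)) = (P.map V).prod ν := by
    rw [(indepFun_iff_map_prod_eq_prod_map_map hV.aemeasurable (hξ n).aemeasurable).1 hVind,
      hlaw n]
  have hG : Measurable fun p : (ℝ≥0∞ × ℝ) × ℝ => p.1.1 * F p.1.2 p.2 :=
    measurable_fst.fst.mul (hF.comp (measurable_fst.snd.prodMk measurable_snd))
  have hind1 : ∀ (f : Ω → ℝ≥0∞), ∫⁻ ω in stayNonneg ξ n, f ω ∂P = ∫⁻ ω, (V ω).1 * f ω ∂P := by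
    intro f
    rw [← lintegral_indicator (measurableSet_stayNonneg hξ n)]
    refine lintegral_congr fun ω => ?_
    by_cases hω : ω ∈ stayNonneg ξ n <;> simp [V, hω]
  have := Measure.isProbabilityMeasure_map (μ := P) hV.aemeasurable
  calc ∫⁻ ω in stayNonneg ξ n, F (walk ξ n ω) (ξ n ω) ∂P
      = ∫⁻ p, p.1.1 * F p.1.2 p.2 ∂(P.map fun ω => (V ω, ξ n ω)) := by
        rw [lintegral_map hG (hV.prodMk (hξ n)), hind1]
    _ = ∫⁻ ω, ∫⁻ x, (V ω).1 * F (V ω).2 x ∂ν ∂P := by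
        rw [hprod, lintegral_prod _ hG.aemeasurable, lintegral_map hG.lintegral_prod_right' hV]
    _ = _ := by
        rw [hind1]
        refine lintegral_congr fun ω => ?_
        exact lintegral_const_mul _ (hF.comp (measurable_const.prodMk measurable_id))

/-- The expected value of the exponential martingale on the event of survival up to time `n`. -/
noncomputable def survivalMass (P : Measure Ω) (ξ : ℕ → Ω → ℝ) (q : ℝ≥0) (θ : ℝ) (n : ℕ) : ℝ≥0∞ :=
  (q : ℝ≥0∞) ^ n * ∫⁻ ω in stayNonneg ξ n, ENNReal.ofReal (Real.exp (-(θ * walk ξ n ω))) ∂P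

/-- The expected value of the exponential martingale on the event of exit at time `n + 1`. -/
noncomputable def exitMass (P : Measure Ω) (ξ : ℕ → Ω → ℝ) (q : ℝ≥0) (θ : ℝ) (n : ℕ) : ℝ≥0∞ :=
  (q : ℝ≥0∞) ^ (n + 1) *
    ∫⁻ ω in firstNeg ξ n, ENNReal.ofReal (Real.exp (-(θ * walk ξ (n + 1) ω))) ∂P

variable {q : ℝ≥0} {θ : ℝ}

lemma survivalMass_eq_add [IsProbabilityMeasure P] (hξ : ∀ k, Measurable (ξ k))
    (hind : ∀ n, IndepFun (fun ω (i : Finset.range n) => ξ i ω) (ξ n) P)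
    (hlaw : ∀ k, P.map (ξ k) = ν)
    (hmart : q * ∫⁻ x, ENNReal.ofReal (Real.exp (-(θ * x))) ∂ν = 1) (n : ℕ) :
    survivalMass P ξ q θ n = survivalMass P ξ q θ (n + 1) + exitMass P ξ q θ n := by
  have hM := setLIntegral_stayNonneg_eq hξ hind hlaw n
    (F := fun y x => ENNReal.ofReal (Real.exp (-(θ * (y + x)))))
    (by unfold Function.uncurry; fun_prop)
  have hsplit : ∀ y x : ℝ, ENNReal.ofReal (Real.exp (-(θ * (y + x)))) =
      ENNReal.ofReal (Real.exp (-(θ * y))) * ENNReal.ofReal (Real.exp (-(θ * x))) := by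
    intro y x
    rw [← ENNReal.ofReal_mul (Real.exp_pos _).le, ← Real.exp_add]
    ring_nf
  have h1 : ∀ y : ℝ, ∫⁻ x, ENNReal.ofReal (Real.exp (-(θ * (y + x)))) ∂ν =
      ENNReal.ofReal (Real.exp (-(θ * y))) * ∫⁻ x, ENNReal.ofReal (Real.exp (-(θ * x))) ∂ν := by
    intro y
    simp_rw [hsplit]
    exact lintegral_const_mul _ (by fun_prop)
  simp_rw [h1, ← walk_succ] at hM
  rw [lintegral_mul_const _ (by have := measurable_walk hξ n; fun_prop)] at hM
  unfold survivalMass exitMass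
  rw [← mul_add, add_comm (lintegral _ _), stayNonneg_succ, firstNeg,
    lintegral_inter_add_sdiff _ _ (measurableSet_walk_neg hξ _), hM]
  calc _ = (q : ℝ≥0∞) ^ n * (∫⁻ ω in stayNonneg ξ n,
        ENNReal.ofReal (Real.exp (-(θ * walk ξ n ω))) ∂P) *
        (q * ∫⁻ x, ENNReal.ofReal (Real.exp (-(θ * x))) ∂ν) := by rw [hmart, mul_one]
    _ = _ := by ring

/-- Optional stopping: the exponential martingale has expected value `1` at the exit time. The part
of the mass that has not left by time `n` is at most `q ^ n`, the walk being nonnegative there. -/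
lemma tsum_exitMass_eq_one [IsProbabilityMeasure P] (hξ : ∀ k, Measurable (ξ k))
    (hind : ∀ n, IndepFun (fun ω (i : Finset.range n) => ξ i ω) (ξ n) P)
    (hlaw : ∀ k, P.map (ξ k) = ν) (hq : q < 1) (hθ : 0 ≤ θ)
    (hmart : q * ∫⁻ x, ENNReal.ofReal (Real.exp (-(θ * x))) ∂ν = 1) :
    ∑' n, exitMass P ξ q θ n = 1 := by
  have hsum : ∀ n, survivalMass P ξ q θ n + ∑ k ∈ Finset.range n, exitMass P ξ q θ k = 1 := by
    intro n
    induction n with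
    | zero => simp [survivalMass, stayNonneg, walk]
    | succ n ih =>
      rw [survivalMass_eq_add hξ hind hlaw hmart n] at ih
      rw [Finset.sum_range_succ, ← ih]
      ring
  have hle : ∀ n, survivalMass P ξ q θ n ≤ (q : ℝ≥0∞) ^ n := by
    intro n
    calc survivalMass P ξ q θ n ≤ (q : ℝ≥0∞) ^ n * ∫⁻ _ in stayNonneg ξ n, 1 ∂P := by
          unfold survivalMass
          gcongr (q : ℝ≥0∞) ^ n * ?_
          refine setLIntegral_mono measurable_const fun ω hω => ?_
          rw [ENNReal.ofReal_le_one, Real.exp_le_one_iff, neg_nonpos]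
          exact mul_nonneg hθ (walk_nonneg_of_mem_stayNonneg hω)
      _ ≤ (q : ℝ≥0∞) ^ n * 1 := by
          gcongr
          rw [lintegral_one, Measure.restrict_apply_univ]
          exact prob_le_one
      _ = _ := mul_one _
  have h0 : Tendsto (survivalMass P ξ q θ) atTop (𝓝 0) :=
    tendsto_of_tendsto_of_tendsto_of_le_of_le tendsto_const_nhds
      (ENNReal.tendsto_pow_atTop_nhds_zero_of_lt_one (by exact_mod_cast hq))
      (fun _ => zero_le) hle
  have h1 := h0.add (ENNReal.tendsto_nat_tsum (exitMass P ξ q θ))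
  simp_rw [hsum, zero_add] at h1
  exact (tendsto_nhds_unique h1 tendsto_const_nhds)

/-- The expectation `E[q ^ N]` for the first time `N ≥ 1` at which the walk is negative. -/
noncomputable def discountedExit (P : Measure Ω) (ξ : ℕ → Ω → ℝ) (q : ℝ≥0) : ℝ≥0∞ :=
  ∑' n, (q : ℝ≥0∞) ^ (n + 1) * P (firstNeg ξ n)

/-- If the exponential of the overshoot below `0`, given that a step started at some `y ≥ 0` ends
below `0`, has expected value at most `K`, then `1 ≤ K * E[q ^ N]`. -/
lemma one_le_mul_discountedExit [IsProbabilityMeasure P] (hξ : ∀ k, Measurable (ξ k))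
    (hind : ∀ n, IndepFun (fun ω (i : Finset.range n) => ξ i ω) (ξ n) P)
    (hlaw : ∀ k, P.map (ξ k) = ν) (hq : q < 1) (hθ : 0 ≤ θ)
    (hmart : q * ∫⁻ x, ENNReal.ofReal (Real.exp (-(θ * x))) ∂ν = 1) {K : ℝ≥0∞}
    (hK : ∀ y, 0 ≤ y → ∫⁻ x in {x | y + x < 0}, ENNReal.ofReal (Real.exp (-(θ * (y + x)))) ∂ν
      ≤ K * ν {x | y + x < 0}) :
    1 ≤ K * discountedExit P ξ q := by
  have hset : ∀ y : ℝ, MeasurableSet {x : ℝ | y + x < 0} := fun y =>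
    measurableSet_lt (by fun_prop) measurable_const
  have hset2 : MeasurableSet {p : ℝ × ℝ | p.1 + p.2 < 0} :=
    measurableSet_lt (by fun_prop) measurable_const
  have hstep : ∀ {g : ℝ → ℝ≥0∞} (_ : Measurable g) (n : ℕ),
      ∫⁻ ω in firstNeg ξ n, g (walk ξ (n + 1) ω) ∂P =
        ∫⁻ ω in stayNonneg ξ n, ∫⁻ x in {x | walk ξ n ω + x < 0}, g (walk ξ n ω + x) ∂ν ∂P := by
    intro g hg n
    have hM := setLIntegral_stayNonneg_eq hξ hind hlaw n
      (F := fun y x => {x | y + x < 0}.indicator (fun x => g (y + x)) x)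
      (by
        have : Measurable fun p : ℝ × ℝ => g (p.1 + p.2) := hg.comp (by fun_prop)
        exact this.indicator hset2)
    simp_rw [lintegral_indicator (hset _)] at hM
    rw [← hM, firstNeg, Set.inter_comm, ← Measure.restrict_restrict (measurableSet_walk_neg hξ _),
      ← lintegral_indicator (measurableSet_walk_neg hξ _)]
    refine lintegral_congr fun ω => ?_
    simp only [Set.indicator_apply, Set.mem_ofPred_eq, walk_succ]
  rw [← tsum_exitMass_eq_one hξ hind hlaw hq hθ hmart, discountedExit, ← ENNReal.tsum_mul_left]
  refine ENNReal.tsum_le_tsum fun n => ?_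
  have h1 := hstep (g := fun z => ENNReal.ofReal (Real.exp (-(θ * z)))) (by fun_prop) n
  have h2 := hstep (g := fun _ => K) measurable_const n
  simp only [lintegral_const, Measure.restrict_apply_univ] at h2
  rw [exitMass, h1, mul_left_comm, h2]
  gcongr (q : ℝ≥0∞) ^ (n + 1) * ?_
  refine setLIntegral_mono' (measurableSet_stayNonneg hξ n) fun ω hω => ?_
  exact hK _ (walk_nonneg_of_mem_stayNonneg hω)

/-- The overshoot of the first step alone bounds `1 - E[q ^ N]` from below. -/
lemma discountedExit_add_le_one [IsProbabilityMeasure P] (hξ : ∀ k, Measurable (ξ k))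
    (hind : ∀ n, IndepFun (fun ω (i : Finset.range n) => ξ i ω) (ξ n) P)
    (hlaw : ∀ k, P.map (ξ k) = ν) (hq : q < 1) (hθ : 0 ≤ θ)
    (hmart : q * ∫⁻ x, ENNReal.ofReal (Real.exp (-(θ * x))) ∂ν = 1) :
    discountedExit P ξ q
      + q * ∫⁻ x in Set.Iio 0, ENNReal.ofReal (Real.exp (-(θ * x)) - 1) ∂ν ≤ 1 := by
  have hmono : ∀ n, (q : ℝ≥0∞) ^ (n + 1) * P (firstNeg ξ n) ≤ exitMass P ξ q θ n := by
    intro n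
    rw [exitMass, ← setLIntegral_one]
    gcongr (q : ℝ≥0∞) ^ (n + 1) * ?_
    refine setLIntegral_mono' (measurableSet_firstNeg hξ n) fun ω hω => ?_
    rw [ENNReal.one_le_ofReal, Real.one_le_exp_iff, neg_nonneg]
    exact mul_nonpos_of_nonneg_of_nonpos hθ (le_of_lt hω.2)
  have h0 : (q : ℝ≥0∞) ^ (0 + 1) * P (firstNeg ξ 0)
      + q * ∫⁻ x in Set.Iio 0, ENNReal.ofReal (Real.exp (-(θ * x)) - 1) ∂ν
      = exitMass P ξ q θ 0 := by
    have hfirst : firstNeg ξ 0 = ξ 0 ⁻¹' Set.Iio 0 := by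
      ext ω; simp [firstNeg, stayNonneg, walk]
    have hw : ∀ ω, walk ξ (0 + 1) ω = ξ 0 ω := by simp [walk]
    simp_rw [exitMass, hw]
    rw [hfirst, zero_add, pow_one, ← mul_add, ← Measure.map_apply (hξ 0) measurableSet_Iio,
      ← setLIntegral_map measurableSet_Iio (f := fun x => ENNReal.ofReal (Real.exp (-(θ * x))))
        (by fun_prop) (hξ 0), hlaw 0, ← setLIntegral_one, ← lintegral_add_left measurable_const]
    congr 1
    refine setLIntegral_congr_fun measurableSet_Iio fun x hx => ?_
    have : 1 ≤ Real.exp (-(θ * x)) := by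
      rw [Real.one_le_exp_iff, neg_nonneg]
      exact mul_nonpos_of_nonneg_of_nonpos hθ (le_of_lt hx)
    simp only [← ENNReal.ofReal_one]
    rw [← ENNReal.ofReal_add zero_le_one (by linarith)]
    ring_nf
  rw [← tsum_exitMass_eq_one hξ hind hlaw hq hθ hmart, discountedExit,
    tsum_eq_zero_add' ENNReal.summable, tsum_eq_zero_add' (f := exitMass P ξ q θ) ENNReal.summable,
    add_right_comm, h0]
  gcongr
  exact hmono _

end Walk

/-! ### The overshoot of a Gaussian step -/

section Gaussian

variable {a : ℝ} {v : ℝ≥0}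

lemma gaussianReal_Iio_pos (a b : ℝ) (hv : v ≠ 0) : 0 < gaussianReal a v (Set.Iio b) := by
  refine pos_iff_ne_zero.2 fun h => ?_
  have := gaussianReal_absolutelyContinuous' a hv h
  simp at this

lemma gaussianReal_Iio_antitone {a a' : ℝ} (h : a ≤ a') (b : ℝ) (v : ℝ≥0) :
    gaussianReal a' v (Set.Iio b) ≤ gaussianReal a v (Set.Iio b) := by
  have h1 : gaussianReal a' v = (gaussianReal a v).map (· + (a' - a)) := by
    rw [gaussianReal_map_add_const]; congr 1; ring
  rw [h1, Measure.map_apply (by fun_prop) measurableSet_Iio]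
  refine measure_mono fun x hx => ?_
  simp only [Set.mem_preimage, Set.mem_Iio] at hx ⊢
  linarith

/-- A Gaussian law with mean and variance proportional to `s` is the image under scaling by `√s` of
one whose variance does not depend on `s`. -/
lemma gaussianReal_eq_map_sqrt_mul (m : ℝ) (v s : ℝ≥0) :
    gaussianReal (m * s) (v * s) = (gaussianReal (m * √(s : ℝ)) v).map (√(s : ℝ) * ·) := by
  rw [gaussianReal_map_const_mul]
  congr 1
  · rw [mul_left_comm, Real.mul_self_sqrt s.coe_nonneg]
  · ext; simp [mul_comm]

/-- Shifting a Gaussian to the right makes its overshoot below `0` stochastically smaller. The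
density ratio `ρ` of the two laws is increasing and `exp (-θ z)` is decreasing, so with the
point `z₀` at which the latter equals `K`, `(exp (-θ z) - K) * (ρ z - ρ z₀) ≤ 0`. -/
lemma integral_exp_sub_gaussianReal_nonpos {θ K y : ℝ} (hθ : 0 < θ) (hK : 1 ≤ K) (hy : 0 ≤ y)
    (hv : v ≠ 0) (h : ∫ z in Set.Iio 0, (Real.exp (-(θ * z)) - K) ∂gaussianReal a v ≤ 0) :
    ∫ z in Set.Iio 0, (Real.exp (-(θ * z)) - K) ∂gaussianReal (a + y) v ≤ 0 := by
  have hv0 : (0 : ℝ) < v := lt_of_le_of_ne v.2 (by exact_mod_cast hv.symm)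
  set z₀ : ℝ := -(Real.log K / θ) with hz₀
  have hz₀le : z₀ ≤ 0 := neg_nonpos.2 (div_nonneg (Real.log_nonneg hK) hθ.le)
  have hKexp : K = Real.exp (-(θ * z₀)) := by
    rw [hz₀, mul_neg, neg_neg, mul_div_cancel₀ _ hθ.ne', Real.exp_log (by linarith)]
  let ρ : ℝ → ℝ := fun z => Real.exp ((2 * (z - a) * y - y ^ 2) / (2 * v))
  have hρ : ∀ z, gaussianPDFReal (a + y) v z = gaussianPDFReal a v z * ρ z := by
    intro z
    simp only [gaussianPDFReal, ρ]
    rw [mul_assoc _⁻¹, ← Real.exp_add]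
    congr 2
    field_simp
    ring
  let f : ℝ → ℝ := (Set.Iio 0).indicator fun z => Real.exp (-(θ * z)) - K
  have hint : ∀ c : ℝ, Integrable f (gaussianReal c v) := by
    intro c
    have h1 : Integrable (fun z => Real.exp (-(θ * z))) (gaussianReal c v) := by
      simpa only [neg_mul] using integrable_exp_mul_gaussianReal (μ := c) (v := v) (-θ)
    exact (h1.sub (integrable_const K)).indicator measurableSet_Iio
  have hint' : ∀ c : ℝ, Integrable (fun z => gaussianPDFReal c v z * f z) := by
    intro c
    have h1 := hint c
    rw [gaussianReal_of_var_ne_zero c hv, integrable_withDensity_iff_integrable_smul'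
      (measurable_gaussianPDF c v) (ae_of_all _ fun _ => gaussianPDF_lt_top)] at h1
    simpa only [toReal_gaussianPDF, smul_eq_mul] using h1
  have hconv : ∀ c : ℝ, ∫ z in Set.Iio 0, (Real.exp (-(θ * z)) - K) ∂gaussianReal c v =
      ∫ z, gaussianPDFReal c v z * f z := by
    intro c
    rw [← integral_indicator measurableSet_Iio, integral_gaussianReal_eq_integral_smul hv]
    rfl
  rw [hconv] at h ⊢
  calc ∫ z, gaussianPDFReal (a + y) v z * f z
      ≤ ∫ z, ρ z₀ * (gaussianPDFReal a v z * f z) := by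
        refine integral_mono (hint' _) ((hint' a).const_mul _) fun z => ?_
        simp only [hρ]
        have hp := gaussianPDFReal_nonneg a v z
        have key : f z * (ρ z - ρ z₀) ≤ 0 := by
          by_cases hz : z < 0
          · simp only [f, Set.indicator_of_mem (Set.mem_Iio.2 hz)]
            rcases le_total z z₀ with hzz | hzz
            · refine mul_nonpos_of_nonneg_of_nonpos (sub_nonneg.2 ?_) (sub_nonpos.2 ?_)
              · rw [hKexp]; gcongr
              · simp only [ρ]; gcongr
            · refine mul_nonpos_of_nonpos_of_nonneg (sub_nonpos.2 ?_) (sub_nonneg.2 ?_)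
              · rw [hKexp]; gcongr
              · simp only [ρ]; gcongr
          · simp [f, hz]
        nlinarith [mul_nonneg_of_nonpos_of_nonpos (neg_nonpos.2 hp) key]
    _ = ρ z₀ * ∫ z, gaussianPDFReal a v z * f z := integral_const_mul _ _
    _ ≤ 0 := mul_nonpos_of_nonneg_of_nonpos (Real.exp_pos _).le h

lemma lintegral_exp_neg_gaussianReal (a θ : ℝ) (v : ℝ≥0) :
    ∫⁻ x, ENNReal.ofReal (Real.exp (-(θ * x))) ∂gaussianReal a v =
      ENNReal.ofReal (Real.exp (-(θ * a) + v * θ ^ 2 / 2)) := by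
  have h1 : Integrable (fun z => Real.exp (-(θ * z))) (gaussianReal a v) := by
    simpa only [neg_mul] using integrable_exp_mul_gaussianReal (μ := a) (v := v) (-θ)
  rw [← ofReal_integral_eq_lintegral_ofReal h1 (ae_of_all _ fun _ => (Real.exp_pos _).le)]
  have h2 := congrFun (mgf_fun_id_gaussianReal (μ := a) (v := v)) (-θ)
  simp only [mgf, neg_mul] at h2
  rw [h2]
  ring_nf

/-- Uniform bound on the overshoot of a Gaussian step over the time `s ≤ 1`: by convexity,
`exp (-θ √s x) - 1 ≤ √s * exp (-θ x)` for `x < 0`. -/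
lemma exists_overshoot_bound (m : ℝ) (hv : v ≠ 0) {θ : ℝ} (hθ : 0 < θ) :
    ∃ C : ℝ, 0 < C ∧ ∀ s : ℝ≥0, 0 < s → s ≤ 1 → ∀ y : ℝ, 0 ≤ y →
      ∫⁻ x in {x | y + x < 0}, ENNReal.ofReal (Real.exp (-(θ * (y + x))))
          ∂gaussianReal (m * s) (v * s)
        ≤ ENNReal.ofReal (1 + C * √(s : ℝ)) * gaussianReal (m * s) (v * s) {x | y + x < 0} := by
  set A : ℝ := Real.exp (θ * |m| + v * θ ^ 2 / 2)
  set p : ℝ := (gaussianReal |m| v).real (Set.Iio 0)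
  have hp : 0 < p := ENNReal.toReal_pos (gaussianReal_Iio_pos _ _ hv).ne' (measure_ne_top _ _)
  have hA : 0 < A := Real.exp_pos _
  refine ⟨A / p, div_pos hA hp, fun s hs hs1 y hy => ?_⟩
  set ε : ℝ := √(s : ℝ)
  have hε0 : 0 ≤ ε := Real.sqrt_nonneg _
  have hε1 : ε ≤ 1 := Real.sqrt_le_one.2 (by exact_mod_cast hs1)
  set K : ℝ := 1 + A / p * ε with hKdef
  have hK1 : 1 ≤ K := by
    have : 0 ≤ A / p * ε := by positivity
    linarith
  have hvs : v * s ≠ 0 := mul_ne_zero hv hs.ne'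
  have hint : ∀ (c : ℝ) (u : ℝ≥0) (t : ℝ),
      Integrable (fun z => Real.exp (-(t * z))) (gaussianReal c u) := by
    intro c u t
    simpa only [neg_mul] using integrable_exp_mul_gaussianReal (μ := c) (v := u) (-t)
  -- the case of a step started at `0`, in the scaling that makes the variance independent of `s`
  have hbase : ∫ z in Set.Iio 0, (Real.exp (-(θ * z)) - K) ∂gaussianReal (m * s) (v * s) ≤ 0 := by
    have hpre : (fun x : ℝ => ε * x) ⁻¹' Set.Iio 0 = Set.Iio 0 := by
      have : 0 < ε := Real.sqrt_pos.2 (by exact_mod_cast hs)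
      ext x; simp [this]
    rw [gaussianReal_eq_map_sqrt_mul, setIntegral_map measurableSet_Iio
      (Measurable.aestronglyMeasurable (by fun_prop)) (by fun_prop), hpre]
    set ν := gaussianReal (m * ε) v
    have h1 : ∫ x in Set.Iio 0, (Real.exp (-(θ * (ε * x))) - K) ∂ν ≤
        ∫ x in Set.Iio 0, (ε * Real.exp (-(θ * x)) - A / p * ε) ∂ν := by
      refine setIntegral_mono_on ?_ ?_ measurableSet_Iio fun x hx => ?_
      · have := (hint (m * ε) v (θ * ε)).sub (integrable_const K)
        simp only [mul_assoc] at this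
        exact this.integrableOn
      · exact (((hint (m * ε) v θ).const_mul ε).sub (integrable_const _)).integrableOn
      · have hc := convexOn_exp.2 (Set.mem_univ (-(θ * x))) (Set.mem_univ 0) hε0
          (sub_nonneg.2 hε1) (by ring)
        simp only [smul_eq_mul, mul_zero, add_zero, Real.exp_zero, mul_one] at hc
        have : -(θ * (ε * x)) = ε * -(θ * x) := by ring
        rw [this, hKdef]
        linarith
    refine h1.trans ?_
    rw [integral_sub ((hint _ _ _).const_mul ε).integrableOn (integrable_const _).integrableOn,
      integral_const_mul, setIntegral_const, smul_eq_mul]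
    have h2 : ∫ x in Set.Iio 0, Real.exp (-(θ * x)) ∂ν ≤ A := by
      refine (setIntegral_le_integral (hint _ _ _) (ae_of_all _ fun _ => (Real.exp_pos _).le)).trans
        ?_
      have h2 := congrFun (mgf_fun_id_gaussianReal (μ := m * ε) (v := v)) (-θ)
      simp only [mgf, neg_mul] at h2
      rw [h2]
      refine Real.exp_le_exp.2 ?_
      have h3 : -(m * ε) ≤ |m| :=
        (neg_le_abs _).trans (by
          rw [abs_mul, abs_of_nonneg hε0]; exact mul_le_of_le_one_right (abs_nonneg _) hε1)
      nlinarith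
    have h3 : p ≤ ν.real (Set.Iio 0) := by
      refine ENNReal.toReal_mono (measure_ne_top _ _) (gaussianReal_Iio_antitone ?_ _ _)
      exact (le_abs_self _).trans (by
          rw [abs_mul, abs_of_nonneg hε0]; exact mul_le_of_le_one_right (abs_nonneg _) hε1)
    have h4 : ε * A ≤ ν.real (Set.Iio 0) * (A / p * ε) := by
      calc ε * A = p * (A / p * ε) := by field_simp
        _ ≤ _ := by gcongr
    have h5 := mul_le_mul_of_nonneg_left h2 hε0
    linarith
  have hshift := integral_exp_sub_gaussianReal_nonpos hθ hK1 hy hvs hbase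
  have hmap : gaussianReal (m * s + y) (v * s) = (gaussianReal (m * s) (v * s)).map (y + ·) := by
    rw [gaussianReal_map_const_add]
  have hset : {x : ℝ | y + x < 0} = (y + ·) ⁻¹' Set.Iio 0 := rfl
  rw [hset, ← setLIntegral_map measurableSet_Iio
    (f := fun z => ENNReal.ofReal (Real.exp (-(θ * z)))) (by fun_prop) (by fun_prop), ← Measure.map_apply (by fun_prop) measurableSet_Iio, ← hmap]
  rw [integral_sub (hint _ _ _).integrableOn (integrable_const _).integrableOn,
      setIntegral_const, smul_eq_mul, sub_nonpos] at hshift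
  rw [← ofReal_integral_eq_lintegral_ofReal (hint _ _ _).integrableOn
    (ae_of_all _ fun _ => (Real.exp_pos _).le)]
  refine (ENNReal.ofReal_le_ofReal hshift).trans ?_
  rw [mul_comm, ENNReal.ofReal_mul (by linarith), ofReal_measureReal]

/-- The expected overshoot of the first step over the time `s` is at least of order `√s`. -/
lemma exists_first_overshoot_bound (m : ℝ) (hv : v ≠ 0) {θ : ℝ} (hθ : 0 < θ) :
    ∃ c : ℝ, 0 < c ∧ ∀ s : ℝ≥0, 0 < s → s ≤ 1 →
      ENNReal.ofReal (c * √(s : ℝ)) ≤ ∫⁻ x in Set.Iio 0, ENNReal.ofReal (Real.exp (-(θ * x)) - 1)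
        ∂gaussianReal (m * s) (v * s) := by
  set p : ℝ := (gaussianReal |m| v).real (Set.Iio (-1))
  have hp : 0 < p := ENNReal.toReal_pos (gaussianReal_Iio_pos _ _ hv).ne' (measure_ne_top _ _)
  refine ⟨θ * p, mul_pos hθ hp, fun s hs hs1 => ?_⟩
  rw [gaussianReal_eq_map_sqrt_mul]
  set ε : ℝ := √(s : ℝ)
  have hε0 : 0 < ε := Real.sqrt_pos.2 (by exact_mod_cast hs)
  have hε1 : ε ≤ 1 := Real.sqrt_le_one.2 (by exact_mod_cast hs1)
  have hpre : (fun x : ℝ => ε * x) ⁻¹' Set.Iio 0 = Set.Iio 0 := by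
    ext x; simp [hε0]
  rw [setLIntegral_map measurableSet_Iio (by fun_prop) (by fun_prop), hpre]
  calc ENNReal.ofReal (θ * p * ε)
      = ENNReal.ofReal (θ * ε) * gaussianReal |m| v (Set.Iio (-1)) := by
        rw [mul_right_comm, ENNReal.ofReal_mul (by positivity), ofReal_measureReal]
    _ ≤ ENNReal.ofReal (θ * ε) * gaussianReal (m * ε) v (Set.Iio (-1)) := by
        refine mul_le_mul_right ?_ _
        refine gaussianReal_Iio_antitone ((le_abs_self _).trans ?_) _ _
        rw [abs_mul, abs_of_pos hε0]
        exact mul_le_of_le_one_right (abs_nonneg _) hε1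
    _ = ∫⁻ _ in Set.Iio (-1), ENNReal.ofReal (θ * ε) ∂gaussianReal (m * ε) v :=
        (setLIntegral_const _ _).symm
    _ ≤ ∫⁻ x in Set.Iio (-1), ENNReal.ofReal (Real.exp (-(θ * (ε * x))) - 1)
          ∂gaussianReal (m * ε) v := by
        refine setLIntegral_mono' measurableSet_Iio fun x hx => ENNReal.ofReal_le_ofReal ?_
        have h1 := Real.add_one_le_exp (-(θ * (ε * x)))
        have h2 : x < -1 := hx
        nlinarith [mul_pos hθ hε0]
    _ ≤ _ := lintegral_mono_set (Set.Iio_subset_Iio (by norm_num))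

end Gaussian

/-! ### Entry times along a grid -/

section EntryTime

variable {Ω E : Type*} {X : ℝ≥0 → Ω → E} {G : Set E} {ω : Ω} {s : ℝ≥0}

lemma discountFactor_nonneg (r : ℝ) (τ : ℝ≥0∞) : 0 ≤ discountFactor r τ := by
  unfold discountFactor
  split_ifs
  exacts [le_rfl, (Real.exp_pos _).le]

lemma entryTime_eq_top (h : ∀ n : ℕ, X ((n + 1 : ℕ) * s) ω ∉ G) :
    entryTime X (positiveMultiples s) G ω = ∞ := by
  rw [entryTime, sInf_eq_top]
  rintro _ ⟨_, ⟨⟨n, hn, rfl⟩, hX⟩, rfl⟩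
  obtain ⟨k, rfl⟩ := Nat.exists_eq_add_of_le' hn
  exact absurd hX (h k)

lemma entryTime_eq_of_first {n : ℕ} (hn : X ((n + 1 : ℕ) * s) ω ∈ G)
    (h : ∀ k < n, X ((k + 1 : ℕ) * s) ω ∉ G) :
    entryTime X (positiveMultiples s) G ω = ((((n + 1 : ℕ) : ℝ≥0) * s : ℝ≥0) : ℝ≥0∞) := by
  refine le_antisymm (sInf_le ⟨_, ⟨⟨n + 1, n.succ_pos, rfl⟩, hn⟩, rfl⟩) (le_sInf ?_)
  rintro _ ⟨_, ⟨⟨m, hm, rfl⟩, hX⟩, rfl⟩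
  obtain ⟨k, rfl⟩ := Nat.exists_eq_add_of_le' hm
  have : n ≤ k := not_lt.1 fun hk => h k hk hX
  rw [ENNReal.coe_le_coe]
  gcongr

/-- If entering `G` at the times of the grid amounts to a walk being negative, then the discount
factor at the entry time is `q ^ N` for the first time `N` at which the walk is negative. -/
lemma ofReal_discountFactor_entryTime {ξ : ℕ → Ω → ℝ} {r : ℝ} {q : ℝ≥0}
    (hq : (q : ℝ) = Real.exp (-(r * s)))
    (h : ∀ n : ℕ, X ((n + 1 : ℕ) * s) ω ∈ G ↔ walk ξ (n + 1) ω < 0) :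
    ENNReal.ofReal (discountFactor r (entryTime X (positiveMultiples s) G ω)) =
      ∑' n, (firstNeg ξ n).indicator (fun _ => (q : ℝ≥0∞) ^ (n + 1)) ω := by
  classical
  by_cases hex : ∃ n : ℕ, walk ξ (n + 1) ω < 0
  · set n := Nat.find hex
    have hn : walk ξ (n + 1) ω < 0 := Nat.find_spec hex
    have hmin : ∀ k < n, ¬ walk ξ (k + 1) ω < 0 := fun k hk => Nat.find_min hex hk
    have hmem : ω ∈ firstNeg ξ n := ⟨fun k hk => not_lt.1 (hmin k hk), hn⟩
    have hnot : ∀ k, k ≠ n → ω ∉ firstNeg ξ k := by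
      rintro k hk ⟨h1, h2⟩
      rcases lt_or_gt_of_ne hk with hlt | hgt
      · exact hmin k hlt h2
      · exact (h1 n hgt).not_gt hn
    rw [tsum_eq_single n fun k hk => Set.indicator_of_notMem (hnot k hk) _,
      Set.indicator_of_mem hmem, entryTime_eq_of_first ((h n).2 hn) fun k hk => by
        rw [h k]; exact hmin k hk]
    rw [discountFactor, if_neg ENNReal.coe_ne_top, ENNReal.coe_toReal, ← ENNReal.coe_pow,
      ← ENNReal.ofReal_coe_nnreal, NNReal.coe_pow, hq, ← Real.exp_nat_mul]
    congr 2
    push_cast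
    ring
  · push Not at hex
    rw [entryTime_eq_top fun n => by rw [h n]; exact (hex n).not_gt, discountFactor, if_pos rfl,
      ENNReal.ofReal_zero, eq_comm, ENNReal.tsum_eq_zero]
    exact fun n => Set.indicator_of_notMem (fun hω => (hex n).not_gt hω.2) _

end EntryTime

/-! ### The projected Black–Scholes process on a grid -/

/-- The increments of the projected process `∑ i, c i * B i t + m * t` over the grid of mesh `s`. -/
def gridIncrement {d : ℕ} {Ω : Type*} (B : Fin d → ℝ≥0 → Ω → ℝ) (c : Fin d → ℝ) (m : ℝ)
    (s : ℝ≥0) (n : ℕ) (ω : Ω) : ℝ :=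
  ∑ i, c i * (B i ((n + 1 : ℕ) * s) ω - B i (n * s) ω) + m * s

lemma walk_gridIncrement {d : ℕ} {Ω : Type*} (B : Fin d → ℝ≥0 → Ω → ℝ) (c : Fin d → ℝ) (m : ℝ)
    (s : ℝ≥0) (n : ℕ) (ω : Ω) :
    walk (gridIncrement B c m s) n ω =
      ∑ i, c i * (B i (n * s) ω - B i 0 ω) + m * ((n * s : ℝ≥0) : ℝ) := by
  induction n with
  | zero => simp [walk]
  | succ n ih =>
    rw [walk_succ, ih, gridIncrement, add_add_add_comm, ← Finset.sum_add_distrib]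
    congr 1
    · exact Finset.sum_congr rfl fun i _ => by ring
    · push_cast; ring

section Model

variable {d : ℕ} {Ω : Type*} [MeasurableSpace Ω] {r : ℝ} {σ : Fin d → ℝ}
  {B : Fin d → ℝ≥0 → Ω → ℝ} {X : ℝ≥0 → Ω → (Fin d → ℝ)} {Q : (Fin d → ℝ) → Measure Ω}

namespace IsBlackScholesModel

lemma measurable_gridIncrement (hX : IsBlackScholesModel r σ B X Q) (c : Fin d → ℝ) (m : ℝ)
    (s : ℝ≥0) (n : ℕ) : Measurable (gridIncrement B c m s n) := by
  have := hX.measurable_B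
  unfold gridIncrement
  fun_prop

/-- The increments of the individual Brownian motions over the grid are jointly independent. -/
lemma iIndepFun_increments (hX : IsBlackScholesModel r σ B X Q) (x : Fin d → ℝ) (s : ℝ≥0) :
    iIndepFun (fun (p : Fin d × ℕ) ω =>
      B p.1 ((p.2 + 1 : ℕ) * s) ω - B p.1 (p.2 * s) ω) (Q x) := by
  have := hX.measurable_B
  refine iIndepFun_uncurry' (X := fun i n ω => B i ((n + 1 : ℕ) * s) ω - B i (n * s) ω)
    (fun i n => by fun_prop) ?_ fun i => ?_
  · exact (hX.indep x).comp (fun _ u n => u ((n + 1 : ℕ) * s) - u (n * s)) fun _ => by fun_prop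
  · exact (hX.isBrownian x i).hasIndepIncrements.nat (t := fun n : ℕ => (n : ℝ≥0) * s)
      fun a b hab => by dsimp only; gcongr

lemma indepFun_gridIncrement (hX : IsBlackScholesModel r σ B X Q) (x c : Fin d → ℝ) (m : ℝ)
    (s : ℝ≥0) (n : ℕ) :
    IndepFun (fun ω (k : Finset.range n) => gridIncrement B c m s k ω)
      (gridIncrement B c m s n) (Q x) := by
  have hB := hX.measurable_B
  have h := (hX.iIndepFun_increments x s).indepFun_finset (Finset.univ ×ˢ Finset.range n)
    (Finset.univ ×ˢ {n}) (by simp +contextual [Finset.disjoint_left, Nat.ne_of_gt])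
    (fun p => by fun_prop)
  refine h.comp
    (φ := fun u (k : Finset.range n) =>
      ∑ i, c i * u ⟨(i, k), Finset.mk_mem_product (Finset.mem_univ i) k.2⟩ + m * s)
    (ψ := fun u => ∑ i, c i * u ⟨(i, n), Finset.mk_mem_product (Finset.mem_univ i)
      (Finset.mem_singleton_self n)⟩ + m * s) ?_ ?_ <;> fun_prop

lemma map_gridIncrement (hX : IsBlackScholesModel r σ B X Q) (x c : Fin d → ℝ) (m : ℝ)
    (s : ℝ≥0) (n : ℕ) {v : ℝ≥0} (hv : (v : ℝ) = ∑ i, c i ^ 2) :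
    (Q x).map (gridIncrement B c m s n) = gaussianReal (m * s) (v * s) := by
  have hB := hX.measurable_B
  have := hX.isProbabilityMeasure x
  let Z : Fin d → Ω → ℝ := fun i ω => c i * (B i ((n + 1 : ℕ) * s) ω - B i (n * s) ω)
  have hZ : ∀ i, HasLaw (Z i) (gaussianReal 0 (.mk (c i ^ 2) (sq_nonneg _) * s)) (Q x) := by
    intro i
    have h1 := gaussianReal_const_mul
      ((hX.isBrownian x i).hasLaw_sub ((n + 1 : ℕ) * s) (n * s)) (c i)
    have h2 : nndist (((n + 1 : ℕ) * s : ℝ≥0) : ℝ) ((n * s : ℝ≥0) : ℝ) = s := by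
      ext
      rw [coe_nndist, Real.dist_eq]
      push_cast
      rw [show ((n : ℝ) + 1) * s - n * s = s by ring, abs_of_nonneg s.coe_nonneg]
    rw [mul_zero, show (((n + 1 : ℕ) * s : ℝ≥0)).1 = (((n + 1 : ℕ) * s : ℝ≥0) : ℝ) from rfl,
      show ((n * s : ℝ≥0)).1 = ((n * s : ℝ≥0) : ℝ) from rfl, h2] at h1
    exact h1
  have hind : iIndepFun Z (Q x) :=
    ((hX.iIndepFun_increments x s).precomp (g := fun i : Fin d => (i, n))
      fun i j h => congrArg Prod.fst h).comp (fun i u => c i * u) fun i => by fun_prop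
  have hsum : ∀ S : Finset (Fin d), (Q x).map (fun ω => ∑ i ∈ S, Z i ω) =
      gaussianReal 0 (∑ i ∈ S, .mk (c i ^ 2) (sq_nonneg _) * s) := by
    intro S
    induction S using Finset.induction_on with
    | empty => simp [Measure.map_const]
    | insert i S hi ih =>
      have h1 : IndepFun (fun ω => ∑ j ∈ S, Z j ω) (Z i) (Q x) := by
        have := hind.indepFun_finsetSum_of_notMem (fun i => by fun_prop) hi
        simpa only [Finset.sum_fn] using this
      have h2 := gaussianReal_add_gaussianReal_of_indepFun h1 ih (hZ i).map_eq
      rw [add_zero] at h2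
      rw [Finset.sum_insert hi, add_comm, ← h2]
      congr 1
      funext ω
      rw [Finset.sum_insert hi, add_comm]
      rfl
  have h3 : gridIncrement B c m s n = (· + m * s) ∘ fun ω => ∑ i, Z i ω := rfl
  rw [h3, ← Measure.map_map (by fun_prop) (by fun_prop), hsum, gaussianReal_map_add_const, zero_add]
  congr 1
  ext
  push_cast
  rw [hv, Finset.sum_mul]

/-- Started at the boundary point `γ` of the half-space, the process is in the half-space at the
time `n s` if and only if the projected walk is negative at time `n`. -/
lemma ae_mem_iff_walk_neg (hX : IsBlackScholesModel r σ B X Q) (α γ : Fin d → ℝ) (s : ℝ≥0) :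
    ∀ᵐ ω ∂Q γ, ∀ n : ℕ, X (n * s) ω ∈ (fun x : Fin d → ℝ => γ + x) '' {x | α ⬝ᵥ x < 0} ↔
      walk (gridIncrement B (fun i => α i * σ i) (α ⬝ᵥ fun i => r - σ i ^ 2 / 2) s) n ω < 0 := by
  have h0 : ∀ᵐ ω ∂Q γ, ∀ i, B i 0 ω = 0 :=
    ae_all_iff.2 fun i => (hX.isBrownian γ i).eval_zero_ae_eq_zero
  filter_upwards [hX.start γ, hX.dynamics γ, h0] with ω hst hdyn hB0 n
  have hmem : X (n * s) ω ∈ (fun x : Fin d → ℝ => γ + x) '' {x | α ⬝ᵥ x < 0} ↔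
      α ⬝ᵥ (X (n * s) ω - γ) < 0 := by
    constructor
    · rintro ⟨x, hx, hxe⟩
      rw [← hxe, add_sub_cancel_left]
      exact hx
    · exact fun h => ⟨_, h, add_sub_cancel _ _⟩
  rw [hmem, walk_gridIncrement]
  have : α ⬝ᵥ (X (n * s) ω - γ) = ∑ i, α i * σ i * (B i (n * s) ω - B i 0 ω) +
      (α ⬝ᵥ fun i => r - σ i ^ 2 / 2) * ((n * s : ℝ≥0) : ℝ) := by
    simp only [dotProduct, Finset.sum_mul, ← Finset.sum_add_distrib, Pi.sub_apply]
    refine Finset.sum_congr rfl fun i _ => ?_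
    rw [hdyn (n * s) i, hst, hB0 i]
    ring
  rw [this]

/-- The discount factor at the entry time is integrable, and its expected value is `E[q ^ N]`. -/
lemma integrable_discountFactor_and_integral_eq (hX : IsBlackScholesModel r σ B X Q)
    (α γ : Fin d → ℝ) {G : Set (Fin d → ℝ)}
    (hG : G = (fun x : Fin d → ℝ => γ + x) '' {x | α ⬝ᵥ x < 0}) (s q : ℝ≥0)
    (hq : (q : ℝ) = Real.exp (-(r * s)))
    (hfin : discountedExit (Q γ)
      (gridIncrement B (fun i => α i * σ i) (α ⬝ᵥ fun i => r - σ i ^ 2 / 2) s) q ≠ ∞) :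
    Integrable (fun ω => discountFactor r (entryTime X (positiveMultiples s) G ω)) (Q γ) ∧
    ∫ ω, discountFactor r (entryTime X (positiveMultiples s) G ω) ∂Q γ =
      (discountedExit (Q γ)
        (gridIncrement B (fun i => α i * σ i) (α ⬝ᵥ fun i => r - σ i ^ 2 / 2) s) q).toReal := by
  set ξ := gridIncrement B (fun i => α i * σ i) (α ⬝ᵥ fun i => r - σ i ^ 2 / 2) s
  have hmeas : ∀ n, MeasurableSet (firstNeg ξ n) :=
    measurableSet_firstNeg fun k => hX.measurable_gridIncrement _ _ _ _
  let F : Ω → ℝ≥0∞ := fun ω => ∑' n, (firstNeg ξ n).indicator (fun _ => (q : ℝ≥0∞) ^ (n + 1)) ω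
  have hF : Measurable F := Measurable.tsum fun n => measurable_const.indicator (hmeas n)
  have hlint : ∫⁻ ω, F ω ∂Q γ = discountedExit (Q γ) ξ q := by
    rw [lintegral_tsum fun n => (measurable_const.indicator (hmeas n)).aemeasurable]
    exact tsum_congr fun n => lintegral_indicator_const (hmeas n) _
  have hae : (fun ω => (F ω).toReal) =ᵐ[Q γ]
      fun ω => discountFactor r (entryTime X (positiveMultiples s) G ω) := by
    filter_upwards [hX.ae_mem_iff_walk_neg α γ s] with ω hω
    simp only [F]
    rw [← ofReal_discountFactor_entryTime (X := X) (G := G) hq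
        fun n => by rw [hG]; exact hω (n + 1),
      ENNReal.toReal_ofReal (discountFactor_nonneg _ _)]
  rw [← hlint] at hfin ⊢
  exact ⟨(integrable_toReal_of_lintegral_ne_top hF.aemeasurable hfin).congr hae,
    by rw [← integral_congr_ae hae, integral_toReal hF.aemeasurable (ae_lt_top hF hfin)]⟩

/-- The two-sided bound of order `√s` for `1 - E^γ[exp (-r τ)]`, from which everything follows. -/
lemma exists_sqrt_bounds (hX : IsBlackScholesModel r σ B X Q) (hr : 0 < r)
    (α γ : Fin d → ℝ) {G : Set (Fin d → ℝ)}
    (hG : G = (fun x : Fin d → ℝ => γ + x) '' {x | α ⬝ᵥ x < 0}) (hv : 0 < ∑ i, (α i * σ i) ^ 2) :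
    ∃ c C : ℝ, 0 < c ∧ 0 < C ∧ ∀ s : ℝ≥0, 0 < s →
      Integrable (fun ω => discountFactor r (entryTime X (positiveMultiples s) G ω)) (Q γ) ∧
      (s ≤ 1 →
        c * √(s : ℝ) ≤ 1 - ∫ ω, discountFactor r (entryTime X (positiveMultiples s) G ω) ∂Q γ ∧
        1 - ∫ ω, discountFactor r (entryTime X (positiveMultiples s) G ω) ∂Q γ
          ≤ C * √(s : ℝ)) := by
  have := hX.isProbabilityMeasure γ
  set a : Fin d → ℝ := fun i => α i * σ i
  set m : ℝ := α ⬝ᵥ fun i => r - σ i ^ 2 / 2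
  let v : ℝ≥0 := ⟨∑ i, a i ^ 2, hv.le⟩
  have hv0 : (0 : ℝ) < v := hv
  have hv1 : v ≠ 0 := fun h => by simp [h] at hv0
  -- `θ` is the positive root of `v θ² / 2 - m θ - r = 0`
  set R : ℝ := √(m ^ 2 + 2 * r * v)
  have hRsq : R ^ 2 = m ^ 2 + 2 * r * v := Real.sq_sqrt (by positivity)
  have hRm : |m| < R := by
    rw [← Real.sqrt_sq_eq_abs]
    exact Real.sqrt_lt_sqrt (sq_nonneg m) (by nlinarith [mul_pos hr hv0])
  set θ : ℝ := (m + R) / v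
  have hθ : 0 < θ := div_pos (by linarith [neg_abs_le m]) hv0
  have hroot : v * θ ^ 2 / 2 - m * θ = r := by
    simp only [θ]
    field_simp
    nlinarith
  obtain ⟨C, hC, hCs⟩ := exists_overshoot_bound m hv1 hθ
  obtain ⟨c, hc, hcs⟩ := exists_first_overshoot_bound m hv1 hθ
  refine ⟨Real.exp (-r) * c, C, by positivity, hC, fun s hs => ?_⟩
  let q : ℝ≥0 := ⟨Real.exp (-(r * s)), (Real.exp_pos _).le⟩
  have hs' : (0 : ℝ) < s := by exact_mod_cast hs
  have hq : (q : ℝ) = Real.exp (-(r * s)) := rfl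
  have hq1 : q < 1 := by
    rw [← NNReal.coe_lt_coe, hq, NNReal.coe_one, Real.exp_lt_one_iff]
    nlinarith
  have hqE : (q : ℝ≥0∞) = ENNReal.ofReal (Real.exp (-(r * s))) := by
    rw [← hq, ENNReal.ofReal_coe_nnreal]
  set ξ := gridIncrement B a m s
  have hξ : ∀ k, Measurable (ξ k) := hX.measurable_gridIncrement a m s
  have hind := hX.indepFun_gridIncrement γ a m s
  have hlaw : ∀ k, (Q γ).map (ξ k) = gaussianReal (m * s) (v * s) := fun k =>
    hX.map_gridIncrement γ a m s k rfl
  have hmart :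
      q * ∫⁻ x, ENNReal.ofReal (Real.exp (-(θ * x))) ∂gaussianReal (m * s) (v * s) = 1 := by
    rw [lintegral_exp_neg_gaussianReal, hqE, ← ENNReal.ofReal_mul (Real.exp_pos _).le,
      ← Real.exp_add, ENNReal.ofReal_eq_one, Real.exp_eq_one_iff, ← hroot]
    push_cast
    ring
  have hle := discountedExit_add_le_one hξ hind hlaw hq1 hθ.le hmart
  have hfin : discountedExit (Q γ) ξ q ≠ ∞ :=
    ((le_self_add.trans hle).trans_lt ENNReal.one_lt_top).ne
  obtain ⟨hint, heq⟩ := hX.integrable_discountFactor_and_integral_eq α γ hG s q hq hfin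
  refine ⟨hint, fun hs1 => ?_⟩
  rw [heq]
  set D := discountedExit (Q γ) ξ q
  have hDtop : ENNReal.ofReal D.toReal = D := ENNReal.ofReal_toReal hfin
  have hs1' : (s : ℝ) ≤ 1 := by exact_mod_cast hs1
  have hsq := Real.sqrt_nonneg (s : ℝ)
  have hD1 : D.toReal ≤ 1 :=
    ENNReal.toReal_le_of_le_ofReal zero_le_one (by simpa using le_self_add.trans hle)
  constructor
  · have h1 : ENNReal.ofReal (D.toReal + Real.exp (-r) * c * √(s : ℝ)) ≤ ENNReal.ofReal 1 := by
      rw [ENNReal.ofReal_add ENNReal.toReal_nonneg (by positivity), hDtop, mul_assoc,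
        ENNReal.ofReal_mul (Real.exp_pos _).le, ENNReal.ofReal_one]
      refine le_trans ?_ hle
      rw [hqE]
      gcongr
      · nlinarith
      · exact hcs s hs hs1
    have h2 := (ENNReal.ofReal_le_ofReal_iff zero_le_one).1 h1
    linarith
  · have h1 := one_le_mul_discountedExit hξ hind hlaw hq1 hθ.le hmart (hCs s hs hs1)
    rw [← ENNReal.ofReal_one] at h1
    change ENNReal.ofReal 1 ≤ _ * D at h1
    rw [← hDtop, ← ENNReal.ofReal_mul (by positivity),
      ENNReal.ofReal_le_ofReal_iff (by positivity)] at h1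
    nlinarith [mul_nonneg hC.le hsq]

end IsBlackScholesModel

end Model

theorem mainTheorem3 {d : ℕ} {Ω : Type*} [MeasurableSpace Ω]
    (r : ℝ) (hr : 0 < r) (σ : Fin d → ℝ)
    (B : Fin d → ℝ≥0 → Ω → ℝ) (X : ℝ≥0 → Ω → (Fin d → ℝ)) (Q : (Fin d → ℝ) → Measure Ω)
    (hX : IsBlackScholesModel r σ B X Q)
    (α γ : Fin d → ℝ) (G : Set (Fin d → ℝ))
    (hG : G = (fun x : Fin d → ℝ => γ + x) '' {x | α ⬝ᵥ x < 0})
    (δ : ℝ) (hδ : δ = Real.sqrt (∑ i, |α i * σ i| ^ 2)) (hδ_pos : 0 < δ)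
    (μ : Fin d → ℝ) (hμ : μ = fun i => r - σ i ^ 2 / 2) :
    (∀ s : ℝ≥0, 0 < s →
      Tendsto (expectedDiscountDifference r X Q G s γ) (𝓝[>] (0 : ℝ≥0))
        (𝓝 (continuityCorrection r X Q G s γ))) ∧
    (0 ≤ α ⬝ᵥ μ →
      ∃ c₀ C₀ : ℝ, 0 < c₀ ∧ 0 < C₀ ∧ ∀ᶠ s : ℝ≥0 in 𝓝[>] (0 : ℝ≥0),
        c₀ * (s : ℝ) ^ ((1 : ℝ) / 2) ≤ continuityCorrection r X Q G s γ ∧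
        continuityCorrection r X Q G s γ ≤ C₀ * (s : ℝ) ^ ((1 : ℝ) / (2 * Real.sqrt 2))) ∧
    (α ⬝ᵥ μ ≤ 0 → |α ⬝ᵥ μ| ^ 2 / (2 * δ ^ 2) < r →
      ∃ c₁ C₁ : ℝ, 0 < c₁ ∧ 0 < C₁ ∧ ∀ᶠ s : ℝ≥0 in 𝓝[>] (0 : ℝ≥0),
        c₁ * (s : ℝ) ^ ((1 : ℝ) / Real.sqrt 2) ≤ continuityCorrection r X Q G s γ ∧
        continuityCorrection r X Q G s γ ≤ C₁ * (s : ℝ) ^ ((1 : ℝ) / 2)) := by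

  have hv : 0 < ∑ i, (α i * σ i) ^ 2 := by
    have h : 0 < ∑ i, |α i * σ i| ^ 2 := Real.sqrt_pos.1 (hδ ▸ hδ_pos)
    simpa only [sq_abs] using h
  obtain ⟨c, C, hc, hC, hb⟩ := hX.exists_sqrt_bounds hr α γ hG hv
  set f : ℝ≥0 → ℝ := fun s =>
    ∫ ω, discountFactor r (entryTime X (positiveMultiples s) G ω) ∂Q γ
  have hsmall : ∀ᶠ s : ℝ≥0 in 𝓝[>] (0 : ℝ≥0), 0 < s ∧ s ≤ 1 := by
    filter_upwards [Ioc_mem_nhdsGT (zero_lt_one' ℝ≥0)] with s hs using hs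
  have hlim : Tendsto f (𝓝[>] (0 : ℝ≥0)) (𝓝 1) := by
    have h1 : Tendsto (fun s : ℝ≥0 => 1 - C * √(s : ℝ)) (𝓝[>] (0 : ℝ≥0)) (𝓝 1) := by
      have h2 : Continuous fun s : ℝ≥0 => 1 - C * √(s : ℝ) := by fun_prop
      simpa using (h2.tendsto 0).mono_left nhdsWithin_le_nhds
    refine tendsto_of_tendsto_of_tendsto_of_le_of_le' h1 tendsto_const_nhds ?_ ?_
    · filter_upwards [hsmall] with s hs
      linarith [((hb s hs.1).2 hs.2).2]
    · filter_upwards [hsmall] with s hs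
      have := mul_nonneg hc.le (Real.sqrt_nonneg (s : ℝ))
      linarith [((hb s hs.1).2 hs.2).1]
  have htend : ∀ s : ℝ≥0, 0 < s →
      Tendsto (expectedDiscountDifference r X Q G s γ) (𝓝[>] (0 : ℝ≥0)) (𝓝 (1 - f s)) := by
    intro s hs
    refine (hlim.sub_const (f s)).congr' ?_
    filter_upwards [self_mem_nhdsWithin] with t ht
    exact (integral_sub (hb t ht).1 (hb s hs).1).symm
  have hcc : ∀ s : ℝ≥0, 0 < s → continuityCorrection r X Q G s γ = 1 - f s := fun s hs =>
    (htend s hs).limUnder_eq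
  -- `1 / (2 √2) ≤ 1 / 2 ≤ 1 / √2`, and a power of `s ≤ 1` decreases in the exponent
  have hpow : ∀ s : ℝ≥0, 0 < s → s ≤ 1 → ∀ {p p' : ℝ}, p ≤ p' → (s : ℝ) ^ p' ≤ (s : ℝ) ^ p :=
    fun s hs hs1 p p' hp => Real.rpow_le_rpow_of_exponent_ge hs hs1 hp
  have hsqrt2 : 1 ≤ √(2 : ℝ) := Real.one_le_sqrt.2 one_le_two
  have hsqrt2' : √(2 : ℝ) ≤ 2 := Real.sqrt_le_iff.2 (by norm_num)
  refine ⟨fun s hs => hcc s hs ▸ htend s hs, fun _ => ⟨c, C, hc, hC, ?_⟩,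
    fun _ _ => ⟨c, C, hc, hC, ?_⟩⟩
  · filter_upwards [hsmall] with s hs
    obtain ⟨h1, h2⟩ := (hb s hs.1).2 hs.2
    rw [Real.sqrt_eq_rpow] at h1 h2
    rw [hcc s hs.1]
    refine ⟨h1, h2.trans (mul_le_mul_of_nonneg_left (hpow s hs.1 hs.2 ?_) hC.le)⟩
    gcongr
    linarith
  · filter_upwards [hsmall] with s hs
    obtain ⟨h1, h2⟩ := (hb s hs.1).2 hs.2
    rw [Real.sqrt_eq_rpow] at h1 h2
    rw [hcc s hs.1]
    refine ⟨(mul_le_mul_of_nonneg_left (hpow s hs.1 hs.2 ?_) hc.le).trans h1, h2⟩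
    gcongr
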